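/- **Setting.** Let $(X,Y,Z)$ be random variables, $X$ and $Y$ with values in standard Borel spaces $\mathcal X$ and $\mathcal Y$, and $Z$ with values in a measurable space $\mathcal Z$. Let $|\mathcal Y|\in\{2,3,\dots\}\cup\{\infty\}$ be the support size of $Y$, i.e. the least cardinality of a set that contains $Y$ with probability one, assumed to be at least $2$; $1/|\mathcal Y|$ is read as $0$ if $|\mathcal Y|=\infty$. Define the expected total variation distance $$\mathrm{ETV}=\frac{1}{1-1/|\mathcal Y|}\,\mathbb E\big[\mathrm{TV}\big(\mathcal L(Y\mid X,Z),\mathcal L(Y\mid Z)\big)\big],\qquad \mathrm{TV}(\nu_1,\nu_2)=\sup_A|\nu_1(A)-\nu_2(A)|.$$ **Algorithm.** Let $(X_i,Y_i,Z_i)_{i\ge1}$ be i.i.d. copies of $(X,Y,Z)$, let $J\ge1$, and, independently for each $i$ and given $(X_i,Y_i,Z_i)$, draw $X_i^{(1)},\dots,X_i^{(J)}$ i.i.d. from $\mathcal L(X\mid Z=Z_i)$. Let $\alpha\in(0,1)$ and let $z_\alpha$ satisfy $1-\Phi(z_\alpha)=\alpha$, where $\Phi$ is the standard Gaussian distribution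 function. For a (measurable) classifier $f:\mathcal X\times\mathcal Y\times\mathcal Z\to[0,1]$ put $$L_i=|f(X_i,Y_i,Z_i)-1|+\frac1J\sum_{j=1}^J|f(X_i^{(j)},Y_i,Z_i)|,\qquad \bar L=\frac1n\sum_{i=1}^nL_i,\qquad \overline{L^2}=\frac1n\sum_{i=1}^nL_i^2,$$ $$L_n^\alpha(f)=\max\left(0,\ \frac{1-\bar L-z_\alpha\sqrt{\overline{L^2}-\bar L^2}/\sqrt n}{1-1/|\mathcal Y|}\right).$$ **Theorem.** (1) For every fixed classifier $f:\mathcal X\times\mathcal Y\times\mathcal Z\to[0,1]$, the limit $\lim_{n\to\infty}\mathbb P(\mathrm{ETV}\ge L_n^\alpha(f))$ exists and is at least $1-\alpha$. (2) Suppose that $Y$ has conditional densities $p(y\mid x,z)$ given $(X,Z)$ and $p(y\mid z)$ given $Z$, jointly measurable, with respect to a common measure on $\mathcal Y$ (for categorical $Y$: probability mass functions), and let $f_{\mathrm{oracle}}(x,y,z)=\mathbb I\big(p(y\mid x,z)>p(y\mid z)\big)$. If $\mathrm{ETV}>0$ (that is, $X$ and $Y$ are not conditionally independent given $Z$), then $$\lim_{n\to\infty}\mathbb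 P\big(\mathrm{ETV}\ge L_n^\alpha(f_{\mathrm{oracle}})\big)=1-\alpha .$$ -/

import Mathlib

open MeasureTheory ProbabilityTheory

namespace Floodgate

noncomputable section

/-- Total variation distance of two (probability) measures:
the supremum of `|ν₁ A - ν₂ A|` over all measurable sets `A`. -/
def tvDist {S : Type*} [MeasurableSpace S] (ν₁ ν₂ : Measure S) : ℝ :=
  ⨆ A : {A : Set S // MeasurableSet A}, |ν₁.real A.1 - ν₂.real A.1|

/-- Support size of a distribution: the least cardinality of a set of full measure
(`⊤` if no finite set has full measure). -/
def supportSize {S : Type*} [MeasurableSpace S] (ν : Measure S) : ℕ∞ :=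
  ⨅ (A : Set S) (_ : ν Aᶜ = 0), A.encard

/-- The factor `1 - 1/k` for a support size `k`, read as `1` for `k = ∞`. -/
def normFactor (k : ℕ∞) : ℝ :=
  if k = ⊤ then 1 else 1 - 1 / (k.toNat : ℝ)

section Law

variable {𝒳 𝒴 𝒵 : Type*} [MeasurableSpace 𝒳] [MeasurableSpace 𝒴] [MeasurableSpace 𝒵]

/-- `ℒ(Y ∣ X, Z)` for `(X, Y, Z) ∼ μ`. -/
def condYgivenXZ [StandardBorelSpace 𝒴] [Nonempty 𝒴]
    (μ : Measure (𝒳 × 𝒴 × 𝒵)) [IsFiniteMeasure μ] : Kernel (𝒳 × 𝒵) 𝒴 :=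
  condDistrib (fun t : 𝒳 × 𝒴 × 𝒵 => t.2.1) (fun t => (t.1, t.2.2)) μ

/-- `ℒ(Y ∣ Z)` for `(X, Y, Z) ∼ μ`. -/
def condYgivenZ [StandardBorelSpace 𝒴] [Nonempty 𝒴]
    (μ : Measure (𝒳 × 𝒴 × 𝒵)) [IsFiniteMeasure μ] : Kernel 𝒵 𝒴 :=
  condDistrib (fun t : 𝒳 × 𝒴 × 𝒵 => t.2.1) (fun t => t.2.2) μ

/-- `ℒ(X ∣ Z)` for `(X, Y, Z) ∼ μ`. -/
def condXgivenZ [StandardBorelSpace 𝒳] [Nonempty 𝒳]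
    (μ : Measure (𝒳 × 𝒴 × 𝒵)) [IsFiniteMeasure μ] : Kernel 𝒵 𝒳 :=
  condDistrib (fun t : 𝒳 × 𝒴 × 𝒵 => t.1) (fun t => t.2.2) μ

/-- Support size of `Y` for `(X, Y, Z) ∼ μ`. -/
def supportSizeY (μ : Measure (𝒳 × 𝒴 × 𝒵)) : ℕ∞ :=
  supportSize (μ.map (fun t => t.2.1))

/-- The expected total variation distance `ETV(X, Y, Z)` for `(X, Y, Z) ∼ μ`. -/
def ETV [StandardBorelSpace 𝒴] [Nonempty 𝒴]
    (μ : Measure (𝒳 × 𝒴 × 𝒵)) [IsFiniteMeasure μ] : ℝ :=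
  1 / normFactor (supportSizeY μ) *
    ∫ t, tvDist (condYgivenXZ μ (t.1, t.2.2)) (condYgivenZ μ t.2.2) ∂μ

/-- `p₁ (x, z) y` is a conditional density `p(y ∣ x, z)` of `Y` given `(X, Z)`
with respect to the reference measure `ν`. -/
structure IsCondDensityXZ [StandardBorelSpace 𝒴] [Nonempty 𝒴]
    (μ : Measure (𝒳 × 𝒴 × 𝒵)) [IsFiniteMeasure μ] (ν : Measure 𝒴)
    (p₁ : 𝒳 × 𝒵 → 𝒴 → ENNReal) : Prop where
  measurable : Measurable (Function.uncurry p₁)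
  eq_withDensity : ∀ᵐ w ∂(μ.map (fun t => (t.1, t.2.2))),
    condYgivenXZ μ w = ν.withDensity (p₁ w)

/-- `p₀ z y` is a conditional density `p(y ∣ z)` of `Y` given `Z`
with respect to the reference measure `ν`. -/
structure IsCondDensityZ [StandardBorelSpace 𝒴] [Nonempty 𝒴]
    (μ : Measure (𝒳 × 𝒴 × 𝒵)) [IsFiniteMeasure μ] (ν : Measure 𝒴)
    (p₀ : 𝒵 → 𝒴 → ENNReal) : Prop where
  measurable : Measurable (Function.uncurry p₀)
  eq_withDensity : ∀ᵐ z ∂(μ.map (fun t => t.2.2)),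
    condYgivenZ μ z = ν.withDensity (p₀ z)

open Classical in
/-- The oracle classifier `𝕀(p(y ∣ x, z) > p(y ∣ z))`. -/
def oracle (p₁ : 𝒳 × 𝒵 → 𝒴 → ENNReal) (p₀ : 𝒵 → 𝒴 → ENNReal) : 𝒳 × 𝒴 × 𝒵 → ℝ :=
  fun t => if p₁ (t.1, t.2.2) t.2.1 > p₀ t.2.2 t.2.1 then 1 else 0

end Law

section Algorithm

variable {Ω 𝒳 𝒴 𝒵 : Type*} [MeasurableSpace Ω] [MeasurableSpace 𝒳] [MeasurableSpace 𝒴]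
  [MeasurableSpace 𝒵]

/-- The random inputs of the algorithm: `(X i, Y i, Z i)` are i.i.d. with law `μ`; given
`(X i, Y i, Z i)`, the resamples `X' i 1, …, X' i J` are i.i.d. with law `ℒ(X ∣ Z = Z i)`;
and the draws belonging to different `i` are independent. -/
structure IsSample [StandardBorelSpace 𝒳] [Nonempty 𝒳]
    (P : Measure Ω) [IsProbabilityMeasure P] (μ : Measure (𝒳 × 𝒴 × 𝒵)) [IsFiniteMeasure μ]
    (J : ℕ) (X : ℕ → Ω → 𝒳) (Y : ℕ → Ω → 𝒴) (Z : ℕ → Ω → 𝒵)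
    (X' : ℕ → Fin J → Ω → 𝒳) : Prop where
  measurable_X : ∀ i, Measurable (X i)
  measurable_Y : ∀ i, Measurable (Y i)
  measurable_Z : ∀ i, Measurable (Z i)
  measurable_X' : ∀ i j, Measurable (X' i j)
  law : ∀ i, P.map (fun ω => (X i ω, Y i ω, Z i ω)) = μ
  resample : ∀ i, ∀ᵐ d ∂μ,
    condDistrib (fun ω (j : Fin J) => X' i j ω) (fun ω => (X i ω, Y i ω, Z i ω)) P d =
      Measure.pi (fun _ : Fin J => condXgivenZ μ d.2.2)
  indep : iIndepFun
    (fun i ω => ((X i ω, Y i ω, Z i ω), fun j : Fin J => X' i j ω)) P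

/-- The loss `L_i` of the classifier `f` on one data point `(x, y, z)` with resamples `x'`. -/
def loss {J : ℕ} (f : 𝒳 × 𝒴 × 𝒵 → ℝ) (x : 𝒳) (y : 𝒴) (z : 𝒵) (x' : Fin J → 𝒳) : ℝ :=
  |f (x, y, z) - 1| + (1 / (J : ℝ)) * ∑ j, |f (x' j, y, z) - 0|

/-- The average of the first `n` terms of a sequence. -/
def average (n : ℕ) (a : ℕ → ℝ) : ℝ := (∑ i ∈ Finset.range n, a i) / n

/-- The floodgate output computed from the losses `L` of the first `n` data points, the Gaussian
quantile `zα` and the support size `k` of `Y`. -/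
def boundOfLosses (k : ℕ∞) (zα : ℝ) (n : ℕ) (L : ℕ → ℝ) : ℝ :=
  max 0 ((1 - average n L
      - zα * √(average n (fun i => L i ^ 2) - average n L ^ 2) / √(n : ℝ)) / normFactor k)

/-- The floodgate lower confidence bound `L_n^α(f)` as a random variable. -/
def lowerBound {J : ℕ} (k : ℕ∞) (zα : ℝ) (f : 𝒳 × 𝒴 × 𝒵 → ℝ)
    (X : ℕ → Ω → 𝒳) (Y : ℕ → Ω → 𝒴) (Z : ℕ → Ω → 𝒵) (X' : ℕ → Fin J → Ω → 𝒳)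
    (n : ℕ) (ω : Ω) : ℝ :=
  boundOfLosses k zα n (fun i => loss f (X i ω) (Y i ω) (Z i ω) (fun j => X' i j ω))

end Algorithm

end

end Floodgate

/-!
Write `τ = expectedTV μ` for the expected total variation distance without its normalisation. The
normalisation is a positive constant, so the bound covers `ETV` exactly when `1 - τ` does not exceed
the one-sided upper confidence limit `average L + z S / √n` for the mean loss, `S` being the
empirical standard deviation of the losses (`lowerBound_le_ETV_iff`).

The losses are i.i.d. and bounded. A resampled point `(X', Y, Z)` has the law under which `X` and `Y`
are conditionally independent given `Z`, so `1 - E L` is the mean over `(X, Z)` of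
`∫ f dℒ(Y ∣ X, Z) - ∫ f dℒ(Y ∣ Z)` (`IsSample.integral_sampleLoss`). This is at most `τ`
(`integral_condY_sub_le_expectedTV`), with equality for the oracle, whose sections are Hahn sets
(`integral_oracle_sub_eq_expectedTV`). Hence `1 - τ ≤ E L`, and the coverage probability tends

* to `1` if the inequality is strict, by the law of large numbers;
* to `1` if the losses are almost surely constant;
* to `Φ(z) = 1 - α` otherwise, by the central limit theorem and Slutsky's theorem.

For the oracle with `τ > 0` only the last case occurs. If its losses were constant, they would equal
`1 - τ < 1`. Given `(X, Y, Z)` the `J` resamples are independent, so if a single one could be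
accepted, all of them could be accepted simultaneously, giving a loss of at least `1`. So no resample
is ever accepted, i.e. the set `{p(· ∣ x, z) > p(· ∣ z)}` is null under `ℒ(Y ∣ Z)`. Existence of
densities with respect to a common measure forces `ℒ(Y ∣ X, Z) ≪ ℒ(Y ∣ Z)`, so that set is null under
`ℒ(Y ∣ X, Z)` as well, and `τ = 0` (`IsSample.variance_sampleLoss_oracle_ne_zero`).
-/

/-! ### Sums of bounded i.i.d. variables -/

namespace Floodgate

open Filter Topology

section IID

variable {Ω : Type*} [MeasurableSpace Ω] {P : Measure Ω} {L : ℕ → Ω → ℝ}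

/-- The empirical standard deviation of the first `n` terms of `L`. -/
noncomputable def empiricalSD (L : ℕ → Ω → ℝ) (n : ℕ) (ω : Ω) : ℝ :=
  √(average n (fun i => L i ω ^ 2) - average n (fun i => L i ω) ^ 2)

lemma measurable_average (hL : ∀ i, Measurable (L i)) (n : ℕ) :
    Measurable fun ω => average n fun i => L i ω := by
  unfold average
  fun_prop

lemma measurable_empiricalSD (hL : ∀ i, Measurable (L i)) (n : ℕ) :
    Measurable (empiricalSD L n) := by
  have h1 := measurable_average hL n
  have h2 := measurable_average (fun i => (hL i).pow_const 2) n
  unfold empiricalSD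
  fun_prop

lemma ae_tendsto_average (hind : iIndepFun L P) (hid : ∀ i, IdentDistrib (L i) (L 0) P P)
    (hint : Integrable (L 0) P) :
    ∀ᵐ ω ∂P, Tendsto (fun n => average n fun i => L i ω) atTop (𝓝 P[L 0]) :=
  strong_law_ae_real L hint (fun _ _ hij => hind.indepFun hij) hid

variable [IsProbabilityMeasure P]

lemma ae_tendsto_empiricalSD (hind : iIndepFun L P)
    (hid : ∀ i, IdentDistrib (L i) (L 0) P P) (hL2 : MemLp (L 0) 2 P) :
    ∀ᵐ ω ∂P, Tendsto (fun n => empiricalSD L n ω) atTop (𝓝 √Var[L 0; P]) := by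
  have h1 := ae_tendsto_average hind hid (hL2.integrable one_le_two)
  have h2 := ae_tendsto_average (L := fun i ω => L i ω ^ 2)
    (hind.comp (fun _ x => x ^ 2) fun _ => by fun_prop)
    (fun i => (hid i).comp (u := fun x : ℝ => x ^ 2) (by fun_prop)) hL2.integrable_sq
  filter_upwards [h1, h2] with ω hω1 hω2
  rw [variance_eq_sub hL2]
  exact (hω2.sub (hω1.pow 2)).sqrt

/-- If `t < E[L 0]`, the upper confidence limit for `E[L 0]` exceeds `t` with probability tending
to one. -/
lemma tendsto_measureReal_upperLimit_of_lt (hL : ∀ i, Measurable (L i)) (hind : iIndepFun L P)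
    (hid : ∀ i, IdentDistrib (L i) (L 0) P P) (hL2 : MemLp (L 0) 2 P) (z : ℝ) {t : ℝ}
    (ht : t < P[L 0]) :
    Tendsto (fun n : ℕ => P.real
      {ω | t ≤ average n (fun i => L i ω) + z * empiricalSD L n ω / √(n : ℝ)}) atTop (𝓝 1) := by
  have key : ∀ᵐ ω ∂P, ∀ᶠ n : ℕ in atTop,
      (ω ∈ {ω | t ≤ average n (fun i => L i ω) + z * empiricalSD L n ω / √(n : ℝ)}
        ↔ ω ∈ Set.univ) := by
    filter_upwards [ae_tendsto_average hind hid (hL2.integrable one_le_two),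
      ae_tendsto_empiricalSD hind hid hL2] with ω h1 h2
    have h3 : Tendsto (fun n : ℕ => √(n : ℝ)) atTop atTop :=
      Real.tendsto_sqrt_atTop.comp tendsto_natCast_atTop_atTop
    have h4 := h1.add ((h2.const_mul z).div_atTop h3)
    rw [add_zero] at h4
    filter_upwards [h4.eventually_const_lt ht] with n hn
    simpa using hn.le
  have := tendsto_measure_of_ae_tendsto_indicator_of_isFiniteMeasure atTop MeasurableSet.univ
    (fun n : ℕ => measurableSet_le measurable_const
      ((measurable_average hL n).add
        (((measurable_empiricalSD hL n).const_mul z).div_const (√(n : ℝ))))) key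
  rw [measure_univ] at this
  exact (ENNReal.tendsto_toReal ENNReal.one_ne_top).comp this

/-- For degenerate variables the upper confidence limit is `E[L 0]` almost surely. -/
lemma tendsto_measureReal_upperLimit_of_variance_eq_zero
    (hid : ∀ i, IdentDistrib (L i) (L 0) P P) (hL2 : MemLp (L 0) 2 P) (z : ℝ) {t : ℝ}
    (ht : t ≤ P[L 0]) (hvar : Var[L 0; P] = 0) :
    Tendsto (fun n : ℕ => P.real
      {ω | t ≤ average n (fun i => L i ω) + z * empiricalSD L n ω / √(n : ℝ)}) atTop (𝓝 1) := by
  have hconst : ∀ᵐ ω ∂P, ∀ i, L i ω = P[L 0] := by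
    refine ae_all_iff.2 fun i => ?_
    have h := ae_eq_integral_of_variance_eq_zero ((hid i).memLp_iff.2 hL2)
      (by rw [(hid i).variance_eq, hvar])
    rwa [(hid i).integral_eq] at h
  refine tendsto_const_nhds.congr' ?_
  filter_upwards [eventually_gt_atTop 0] with n hn
  have hn' : (n : ℝ) ≠ 0 := by exact_mod_cast hn.ne'
  have hae : ∀ᵐ ω ∂P, t ≤ average n (fun i => L i ω) + z * empiricalSD L n ω / √(n : ℝ) := by
    filter_upwards [hconst] with ω hω
    simpa [empiricalSD, average, hω, hn'] using ht
  rw [measureReal_def, measure_congr (eventuallyEq_univ.2 hae)]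
  simp

/-- Studentised central limit theorem, as coverage of the upper confidence limit for `E[L 0]`. -/
lemma tendsto_measureReal_upperLimit_mean (hL : ∀ i, Measurable (L i)) (hind : iIndepFun L P)
    (hid : ∀ i, IdentDistrib (L i) (L 0) P P) (hL2 : MemLp (L 0) 2 P) (z : ℝ)
    (hvar : Var[L 0; P] ≠ 0) :
    Tendsto (fun n : ℕ => P.real
      {ω | P[L 0] ≤ average n (fun i => L i ω) + z * empiricalSD L n ω / √(n : ℝ)})
      atTop (𝓝 (cdf (gaussianReal 0 1) z)) := by
  set σ : ℝ := √Var[L 0; P] with hσ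
  have hσ0 : 0 < σ := Real.sqrt_pos.2 (lt_of_le_of_ne (variance_nonneg _ _) hvar.symm)
  -- the Gaussian limit is realised as `x ↦ -σ x`, so that the limiting event is `x ≤ z`
  have hlaw : HasLaw (fun x : ℝ => -σ * x) (gaussianReal 0 Var[L 0; P].toNNReal)
      (gaussianReal 0 1) := by
    have := gaussianReal_const_mul (X := id) (P := gaussianReal 0 1) (μ := 0) (v := 1)
      (HasLaw.id) (-σ)
    convert! this using 2
    · simp
    · ext
      simp [hσ, Real.sq_sqrt (variance_nonneg (L 0) P), variance_nonneg]
  have hclt := tendstoInDistribution_inv_sqrt_mul_sum_sub hlaw hL2 hind hid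
  have hsd : TendstoInMeasure P (fun n ω => z * empiricalSD L n ω) atTop (fun _ => z * σ) := by
    refine tendstoInMeasure_of_tendsto_ae
      (fun n => ((measurable_empiricalSD hL n).const_mul z).aestronglyMeasurable) ?_
    filter_upwards [ae_tendsto_empiricalSD hind hid hL2] with ω h using h.const_mul z
  have hsum := hclt.add_of_tendstoInMeasure_const hsd
    fun n => ((measurable_empiricalSD hL n).const_mul z).aemeasurable
  have hIci : (fun x : ℝ => -σ * x + z * σ) ⁻¹' Set.Ici 0 = Set.Iic z := by
    ext x
    simp only [Set.mem_preimage, Set.mem_Ici, Set.mem_Iic]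
    constructor <;> intro h <;> nlinarith
  have hmeas : Measurable fun x : ℝ => -σ * x + z * σ := by fun_prop
  have hport := ProbabilityMeasure.tendsto_measure_of_null_frontier_of_tendsto' hsum.tendsto
    (E := Set.Ici 0) (by
      rw [frontier_Ici]
      simp only [ProbabilityMeasure.coe_mk]
      rw [Measure.map_apply hmeas (measurableSet_singleton _)]
      have : (fun x : ℝ => -σ * x + z * σ) ⁻¹' {0} = {z} := by
        ext x
        simp only [Set.mem_preimage, Set.mem_singleton_iff]
        constructor
        · intro h
          have : σ * (z - x) = 0 := by linarith
          rcases mul_eq_zero.1 this with h | h <;> linarith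
        · rintro rfl; ring
      rw [this]
      have := nullSingletonClass_gaussianReal (μ := 0) (v := 1) one_ne_zero
      exact measure_singleton z)
  simp only [ProbabilityMeasure.coe_mk] at hport
  rw [Measure.map_apply hmeas measurableSet_Ici, hIci] at hport
  rw [cdf_eq_real]
  refine ((ENNReal.tendsto_toReal (measure_ne_top _ _)).comp hport).congr' ?_
  filter_upwards [eventually_gt_atTop 0] with n hn
  have hs : 0 < √(n : ℝ) := Real.sqrt_pos.2 (by exact_mod_cast hn)
  rw [Function.comp_apply, Measure.map_apply_of_aemeasurable (hsum.forall_aemeasurable n)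
    measurableSet_Ici, Measure.real]
  congr 2
  ext ω
  have hn' : (n : ℝ) = √(n : ℝ) * √(n : ℝ) := (Real.mul_self_sqrt n.cast_nonneg).symm
  have h : √(n : ℝ) * (average n (fun i => L i ω) + z * empiricalSD L n ω / √(n : ℝ) - P[L 0])
      = (√(n : ℝ))⁻¹ * (∑ k ∈ Finset.range n, L k ω - n * P[L 0]) + z * empiricalSD L n ω := by
    unfold average
    have h2 : (∑ k ∈ Finset.range n, L k ω) / (n : ℝ)
      = (∑ k ∈ Finset.range n, L k ω) / (√(n : ℝ) * √(n : ℝ)) := by rw [← hn']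
    have h3 : (n : ℝ) * P[L 0] = √(n : ℝ) * √(n : ℝ) * P[L 0] := by rw [← hn']
    rw [h2, h3]
    field_simp
    ring
  simp only [Set.mem_preimage, Set.mem_Ici, Pi.add_apply, Set.mem_ofPred_eq]
  rw [← h, mul_nonneg_iff_of_pos_left hs, sub_nonneg]

end IID

end Floodgate

/-! ### Total variation distance and Hahn decompositions -/

namespace Floodgate

section TotalVariation

variable {S : Type*} [MeasurableSpace S] {κ η ν : Measure S} {A : Set S}

/-- Where one density exceeds another is a Hahn set, even if the reference measure is not
σ-finite. -/
lemma isHahnDecomposition_withDensity {p₁ p₀ : S → ENNReal} (h₁ : Measurable p₁)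
    (h₀ : Measurable p₀) :
    IsHahnDecomposition (ν.withDensity p₀) (ν.withDensity p₁) {y | p₀ y < p₁ y} where
  measurableSet := measurableSet_lt h₀ h₁
  le_on := by
    have hA : MeasurableSet {y | p₀ y < p₁ y} := measurableSet_lt h₀ h₁
    rw [restrict_withDensity hA, restrict_withDensity hA]
    refine withDensity_mono ?_
    filter_upwards [ae_restrict_mem hA] with y hy using le_of_lt hy
  ge_on_compl := by
    have hA : MeasurableSet {y | p₀ y < p₁ y}ᶜ := (measurableSet_lt h₀ h₁).compl
    rw [restrict_withDensity hA, restrict_withDensity hA]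
    refine withDensity_mono ?_
    filter_upwards [ae_restrict_mem hA] with y hy using not_lt.1 hy

lemma tvDist_nonneg (κ η : Measure S) : 0 ≤ tvDist κ η :=
  Real.iSup_nonneg fun _ => abs_nonneg _

variable [IsProbabilityMeasure κ] [IsProbabilityMeasure η]

/-- Among all `[0, 1]`-valued functions the indicator of a Hahn set best separates two
measures: `κ - η` is nonnegative on the set and nonpositive off it. -/
lemma integral_sub_integral_le_of_isHahnDecomposition (hA : IsHahnDecomposition η κ A)
    {f : S → ℝ} (hf : Measurable f) (hf01 : ∀ y, f y ∈ Set.Icc (0 : ℝ) 1) :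
    ∫ y, f y ∂κ - ∫ y, f y ∂η ≤ κ.real A - η.real A := by
  have hint : ∀ (m : Measure S) [IsFiniteMeasure m], Integrable f m := fun m _ =>
    Integrable.of_bound hf.aestronglyMeasurable 1
      (ae_of_all _ fun y => by rw [Real.norm_of_nonneg (hf01 y).1]; exact (hf01 y).2)
  have hκ := integral_add_compl hA.measurableSet (hint κ)
  have hη := integral_add_compl hA.measurableSet (hint η)
  have h1 : ∫ y in Aᶜ, f y ∂κ ≤ ∫ y in Aᶜ, f y ∂η :=
    integral_mono_measure hA.ge_on_compl (ae_of_all _ fun y => (hf01 y).1) (hint _)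
  have h2 : ∫ y in A, (1 - f y) ∂η ≤ ∫ y in A, (1 - f y) ∂κ :=
    integral_mono_measure hA.le_on (ae_of_all _ fun y => sub_nonneg.2 (hf01 y).2)
      ((integrable_const _).sub (hint _))
  rw [integral_sub (integrable_const _) (hint _), integral_sub (integrable_const _) (hint _)] at h2
  simp only [integral_const, measureReal_restrict_apply_univ, smul_eq_mul, mul_one] at h2
  linarith

lemma measureReal_sub_le_of_isHahnDecomposition (hA : IsHahnDecomposition η κ A) {B : Set S}
    (hB : MeasurableSet B) : κ.real B - η.real B ≤ κ.real A - η.real A := by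
  have h := integral_sub_integral_le_of_isHahnDecomposition hA
    (f := B.indicator 1) (measurable_one.indicator hB)
    (fun y => by by_cases hy : y ∈ B <;> simp [hy])
  rwa [integral_indicator_one hB, integral_indicator_one hB] at h

/-- Total variation distance is attained on a Hahn set. -/
lemma tvDist_eq_of_isHahnDecomposition (hA : IsHahnDecomposition η κ A) :
    tvDist κ η = κ.real A - η.real A := by
  have hle : ∀ B : {B : Set S // MeasurableSet B},
      |κ.real B.1 - η.real B.1| ≤ κ.real A - η.real A := by
    rintro ⟨B, hB⟩
    refine abs_le.2 ⟨?_, measureReal_sub_le_of_isHahnDecomposition hA hB⟩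
    have := measureReal_sub_le_of_isHahnDecomposition hA hB.compl
    rw [probReal_compl_eq_one_sub hB, probReal_compl_eq_one_sub hB] at this
    linarith
  have : Nonempty {B : Set S // MeasurableSet B} := ⟨⟨∅, MeasurableSet.empty⟩⟩
  exact le_antisymm (ciSup_le hle) ((le_abs_self _).trans
    (le_ciSup (f := fun B : {B : Set S // MeasurableSet B} => |κ.real B.1 - η.real B.1|)
      ⟨_, Set.forall_mem_range.2 hle⟩ ⟨A, hA.measurableSet⟩))

lemma tvDist_le_one : tvDist κ η ≤ 1 := by
  obtain ⟨A, hA⟩ := exists_isHahnDecomposition η κ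
  rw [tvDist_eq_of_isHahnDecomposition hA]
  linarith [measureReal_le_one (μ := κ) (s := A), measureReal_nonneg (μ := η) (s := A)]

lemma integral_sub_integral_le_tvDist {f : S → ℝ} (hf : Measurable f)
    (hf01 : ∀ y, f y ∈ Set.Icc (0 : ℝ) 1) :
    ∫ y, f y ∂κ - ∫ y, f y ∂η ≤ tvDist κ η := by
  obtain ⟨A, hA⟩ := exists_isHahnDecomposition η κ
  rw [tvDist_eq_of_isHahnDecomposition hA]
  exact integral_sub_integral_le_of_isHahnDecomposition hA hf hf01

end TotalVariation

/-- The Radon–Nikodym derivatives with respect to `κ + η` provide jointly measurable Hahn sets,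
whence the total variation distance between two kernels is measurable in the parameter. -/
lemma measurable_tvDist_kernel {T S : Type*} [MeasurableSpace T] [MeasurableSpace S]
    [MeasurableSpace.CountablyGenerated S] (κ η : Kernel T S) [IsMarkovKernel κ]
    [IsMarkovKernel η] : Measurable fun t => tvDist (κ t) (η t) := by
  set A : Set (T × S) :=
    {u | η.rnDeriv (κ + η) u.1 u.2 < κ.rnDeriv (κ + η) u.1 u.2} with hAdef
  have hA : MeasurableSet A :=
    measurableSet_lt (Kernel.measurable_rnDeriv _ _) (Kernel.measurable_rnDeriv _ _)
  have hac₁ : ∀ t, κ t ≪ (κ + η) t := fun t =>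
    Measure.absolutelyContinuous_of_le (Measure.le_add_right le_rfl)
  have hac₀ : ∀ t, η t ≪ (κ + η) t := fun t =>
    Measure.absolutelyContinuous_of_le (Measure.le_add_left le_rfl)
  have hahn : ∀ t, IsHahnDecomposition (η t) (κ t) (Prod.mk t ⁻¹' A) := fun t => by
    have h := isHahnDecomposition_withDensity (ν := (κ + η) t)
      (Kernel.measurable_rnDeriv_right κ (κ + η) t) (Kernel.measurable_rnDeriv_right η (κ + η) t)
    rwa [← Kernel.withDensity_apply _ (Kernel.measurable_rnDeriv _ _),
      ← Kernel.withDensity_apply _ (Kernel.measurable_rnDeriv _ _),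
      Kernel.withDensity_rnDeriv_eq (hac₁ t), Kernel.withDensity_rnDeriv_eq (hac₀ t)] at h
  simp_rw [fun t => tvDist_eq_of_isHahnDecomposition (hahn t)]
  exact (Kernel.measurable_kernel_prodMk_left hA).ennreal_toReal.sub
    (Kernel.measurable_kernel_prodMk_left hA).ennreal_toReal

end Floodgate

/-! ### Disintegrations of the law of `(X, Y, Z)` -/

namespace Floodgate

lemma integral_eq_integral_condDistrib {α β γ : Type*} [MeasurableSpace α] [MeasurableSpace β]
    [MeasurableSpace γ] [StandardBorelSpace γ] [Nonempty γ] {P : Measure α} [IsFiniteMeasure P]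
    {U : α → β} {V : α → γ} (hU : Measurable U) (hV : Measurable V) {F : β × γ → ℝ}
    (hF : Measurable F) {C : ℝ} (hC : ∀ u, ‖F u‖ ≤ C) :
    ∫ a, F (U a, V a) ∂P = ∫ a, ∫ v, F (U a, v) ∂condDistrib V U P (U a) ∂P := by
  calc ∫ a, F (U a, V a) ∂P = ∫ u, F u ∂(P.map fun a => (U a, V a)) :=
        (integral_map (hU.prodMk hV).aemeasurable hF.aestronglyMeasurable).symm
    _ = ∫ b, ∫ v, F (b, v) ∂condDistrib V U P b ∂(P.map U) := by
        rw [← compProd_map_condDistrib hV.aemeasurable, Measure.integral_compProd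
          (Integrable.of_bound hF.aestronglyMeasurable C (ae_of_all _ hC))]
    _ = _ := integral_map hU.aemeasurable
        (hF.stronglyMeasurable.integral_kernel_prod_right').aestronglyMeasurable

lemma oracle_mem_Icc {𝒳 𝒴 𝒵 : Type*} {p₁ : 𝒳 × 𝒵 → 𝒴 → ENNReal} {p₀ : 𝒵 → 𝒴 → ENNReal}
    (t : 𝒳 × 𝒴 × 𝒵) : oracle p₁ p₀ t ∈ Set.Icc (0 : ℝ) 1 := by
  unfold oracle
  split_ifs <;> simp

section Law

variable {𝒳 𝒴 𝒵 : Type*} [MeasurableSpace 𝒳] [MeasurableSpace 𝒴] [MeasurableSpace 𝒵]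
  {μ : Measure (𝒳 × 𝒴 × 𝒵)}

instance [StandardBorelSpace 𝒴] [Nonempty 𝒴] [IsFiniteMeasure μ] :
    IsMarkovKernel (condYgivenXZ μ) := by unfold condYgivenXZ; infer_instance

instance [StandardBorelSpace 𝒴] [Nonempty 𝒴] [IsFiniteMeasure μ] :
    IsMarkovKernel (condYgivenZ μ) := by unfold condYgivenZ; infer_instance

instance [StandardBorelSpace 𝒳] [Nonempty 𝒳] [IsFiniteMeasure μ] :
    IsMarkovKernel (condXgivenZ μ) := by unfold condXgivenZ; infer_instance

lemma measurable_integral_condYgivenXZ [StandardBorelSpace 𝒴] [Nonempty 𝒴] [IsFiniteMeasure μ]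
    {f : 𝒳 × 𝒴 × 𝒵 → ℝ} (hf : Measurable f) :
    Measurable fun t : 𝒳 × 𝒴 × 𝒵 => ∫ y, f (t.1, y, t.2.2) ∂condYgivenXZ μ (t.1, t.2.2) := by
  have hF : Measurable fun u : (𝒳 × 𝒵) × 𝒴 => f (u.1.1, u.2, u.1.2) := by fun_prop
  exact (hF.stronglyMeasurable.integral_kernel_prod_right' (κ := condYgivenXZ μ)).measurable.comp
    (g := fun w : 𝒳 × 𝒵 => ∫ y, f (w.1, y, w.2) ∂condYgivenXZ μ w)
    (f := fun t : 𝒳 × 𝒴 × 𝒵 => (t.1, t.2.2)) (by fun_prop)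

lemma measurable_integral_condYgivenZ [StandardBorelSpace 𝒴] [Nonempty 𝒴] [IsFiniteMeasure μ]
    {f : 𝒳 × 𝒴 × 𝒵 → ℝ} (hf : Measurable f) :
    Measurable fun u : 𝒵 × 𝒳 => ∫ y, f (u.2, y, u.1) ∂condYgivenZ μ u.1 := by
  have hF : Measurable fun u : (𝒵 × 𝒳) × 𝒴 => f (u.1.2, u.2, u.1.1) := by fun_prop
  exact (hF.stronglyMeasurable.integral_kernel_prod_right'
    (κ := (condYgivenZ μ).comap Prod.fst measurable_fst)).measurable

lemma measurable_integral_condXgivenZ [StandardBorelSpace 𝒳] [Nonempty 𝒳] [IsFiniteMeasure μ]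
    {f : 𝒳 × 𝒴 × 𝒵 → ℝ} (hf : Measurable f) :
    Measurable fun u : 𝒵 × 𝒴 => ∫ x, f (x, u.2, u.1) ∂condXgivenZ μ u.1 := by
  have hF : Measurable fun u : (𝒵 × 𝒴) × 𝒳 => f (u.2, u.1.2, u.1.1) := by fun_prop
  exact (hF.stronglyMeasurable.integral_kernel_prod_right'
    (κ := (condXgivenZ μ).comap Prod.fst measurable_fst)).measurable

lemma integral_mem_Icc {S : Type*} [MeasurableSpace S] {κ : Measure S} [IsProbabilityMeasure κ]
    {f : S → ℝ} (hf : ∀ y, f y ∈ Set.Icc (0 : ℝ) 1) : ∫ y, f y ∂κ ∈ Set.Icc (0 : ℝ) 1 := by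
  refine ⟨integral_nonneg fun y => (hf y).1, ?_⟩
  have := integral_mono_of_nonneg (μ := κ) (ae_of_all _ fun y => (hf y).1)
    (integrable_const (1 : ℝ)) (ae_of_all _ fun y => (hf y).2)
  simpa using this

lemma norm_le_one_of_mem_Icc {a : ℝ} (ha : a ∈ Set.Icc (0 : ℝ) 1) : ‖a‖ ≤ 1 := by
  rw [Real.norm_of_nonneg ha.1]; exact ha.2

lemma integrable_of_mem_Icc {S : Type*} [MeasurableSpace S] {m : Measure S} [IsFiniteMeasure m]
    {f : S → ℝ} (hf : Measurable f) (hf01 : ∀ y, f y ∈ Set.Icc (0 : ℝ) 1) : Integrable f m :=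
  Integrable.of_bound hf.aestronglyMeasurable 1
    (ae_of_all _ fun y => norm_le_one_of_mem_Icc (hf01 y))

lemma integral_eq_integral_condYgivenXZ [StandardBorelSpace 𝒴] [Nonempty 𝒴] [IsFiniteMeasure μ]
    {f : 𝒳 × 𝒴 × 𝒵 → ℝ} (hf : Measurable f) (hf01 : ∀ t, f t ∈ Set.Icc (0 : ℝ) 1) :
    ∫ t, f t ∂μ = ∫ t, ∫ y, f (t.1, y, t.2.2) ∂condYgivenXZ μ (t.1, t.2.2) ∂μ :=
  integral_eq_integral_condDistrib (U := fun t : 𝒳 × 𝒴 × 𝒵 => (t.1, t.2.2))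
    (V := fun t => t.2.1) (by fun_prop) (by fun_prop)
    (F := fun u : (𝒳 × 𝒵) × 𝒴 => f (u.1.1, u.2, u.1.2)) (by fun_prop)
    (fun _ => norm_le_one_of_mem_Icc (hf01 _))

lemma measurable_oracle {p₁ : 𝒳 × 𝒵 → 𝒴 → ENNReal} {p₀ : 𝒵 → 𝒴 → ENNReal}
    (h₁ : Measurable (Function.uncurry p₁))
    (h₀ : Measurable (Function.uncurry p₀)) : Measurable (oracle p₁ p₀) := by
  classical
  refine Measurable.ite (measurableSet_lt ?_ ?_) measurable_const measurable_const
  · exact h₀.comp (f := fun t : 𝒳 × 𝒴 × 𝒵 => (t.2.2, t.2.1)) (by fun_prop)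
  · exact h₁.comp (f := fun t : 𝒳 × 𝒴 × 𝒵 => ((t.1, t.2.2), t.2.1)) (by fun_prop)

lemma integral_oracle {p₁ : 𝒳 × 𝒵 → 𝒴 → ENNReal} {p₀ : 𝒵 → 𝒴 → ENNReal}
    (h₁ : Measurable (Function.uncurry p₁))
    (h₀ : Measurable (Function.uncurry p₀)) (m : Measure 𝒴) (x : 𝒳) (z : 𝒵) :
    ∫ y, oracle p₁ p₀ (x, y, z) ∂m = m.real {y | p₀ z y < p₁ (x, z) y} := by
  classical
  rw [← integral_indicator_one (measurableSet_lt h₀.of_uncurry_left h₁.of_uncurry_left)]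
  congr 1
  ext y
  simp only [oracle, Set.indicator_apply]
  rfl

variable [StandardBorelSpace 𝒴] [Nonempty 𝒴] [IsFiniteMeasure μ]

/-- Replacing `X` by a draw from `ℒ(X ∣ Z)` amounts to replacing `Y` by a draw from `ℒ(Y ∣ Z)`:
both yield the law under which `X` and `Y` are conditionally independent given `Z`. -/
lemma integral_condXgivenZ_eq_integral_condYgivenZ [StandardBorelSpace 𝒳] [Nonempty 𝒳]
    {f : 𝒳 × 𝒴 × 𝒵 → ℝ} (hf : Measurable f) (hf01 : ∀ t, f t ∈ Set.Icc (0 : ℝ) 1) :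
    ∫ t, ∫ x, f (x, t.2.1, t.2.2) ∂condXgivenZ μ t.2.2 ∂μ
      = ∫ t, ∫ y, f (t.1, y, t.2.2) ∂condYgivenZ μ t.2.2 ∂μ := by
  have hY := integral_eq_integral_condDistrib (P := μ) (U := fun t : 𝒳 × 𝒴 × 𝒵 => t.2.2)
    (V := fun t => t.2.1) (by fun_prop) (by fun_prop)
    (measurable_integral_condXgivenZ (μ := μ) hf)
    (fun u => norm_le_one_of_mem_Icc (integral_mem_Icc fun _ => hf01 _))
  have hX := integral_eq_integral_condDistrib (P := μ) (U := fun t : 𝒳 × 𝒴 × 𝒵 => t.2.2)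
    (V := fun t => t.1) (by fun_prop) (by fun_prop)
    (measurable_integral_condYgivenZ (μ := μ) hf)
    (fun u => norm_le_one_of_mem_Icc (integral_mem_Icc fun _ => hf01 _))
  refine hY.trans (Eq.trans ?_ hX.symm)
  refine integral_congr_ae (ae_of_all _ fun t => ?_)
  exact integral_integral_swap (μ := condYgivenZ μ t.2.2) (ν := condXgivenZ μ t.2.2)
    (f := fun y x => f (x, y, t.2.2))
    (integrable_of_mem_Icc (f := fun u : 𝒴 × 𝒳 => f (u.2, u.1, t.2.2)) (by fun_prop)
      fun _ => hf01 _)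

lemma measurable_tvDist_cond :
    Measurable fun t : 𝒳 × 𝒴 × 𝒵 =>
      tvDist (condYgivenXZ μ (t.1, t.2.2)) (condYgivenZ μ t.2.2) :=
  (measurable_tvDist_kernel (condYgivenXZ μ)
    ((condYgivenZ μ).comap Prod.snd measurable_snd)).comp
    (f := fun t : 𝒳 × 𝒴 × 𝒵 => (t.1, t.2.2)) (by fun_prop)

/-- The expected total variation distance without the normalisation by the support size. -/
noncomputable def expectedTV (μ : Measure (𝒳 × 𝒴 × 𝒵)) [IsFiniteMeasure μ] : ℝ :=
  ∫ t, tvDist (condYgivenXZ μ (t.1, t.2.2)) (condYgivenZ μ t.2.2) ∂μ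

lemma integral_condY_sub_le_expectedTV {f : 𝒳 × 𝒴 × 𝒵 → ℝ} (hf : Measurable f)
    (hf01 : ∀ t, f t ∈ Set.Icc (0 : ℝ) 1) :
    ∫ t, f t ∂μ - ∫ t, ∫ y, f (t.1, y, t.2.2) ∂condYgivenZ μ t.2.2 ∂μ ≤ expectedTV μ := by
  rw [integral_eq_integral_condYgivenXZ hf hf01, ← integral_sub]
  · refine integral_mono ((integrable_of_mem_Icc (measurable_integral_condYgivenXZ hf)
      fun _ => integral_mem_Icc fun _ => hf01 _).sub (integrable_of_mem_Icc
        ((measurable_integral_condYgivenZ hf).comp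
          (f := fun t : 𝒳 × 𝒴 × 𝒵 => (t.2.2, t.1)) (by fun_prop))
        fun _ => integral_mem_Icc fun _ => hf01 _))
      (integrable_of_mem_Icc measurable_tvDist_cond
        fun _ => ⟨tvDist_nonneg _ _, tvDist_le_one⟩) fun t => ?_
    exact integral_sub_integral_le_tvDist (f := fun y => f (t.1, y, t.2.2)) (by fun_prop)
      fun _ => hf01 _
  · exact integrable_of_mem_Icc (measurable_integral_condYgivenXZ hf)
      fun _ => integral_mem_Icc fun _ => hf01 _
  · exact integrable_of_mem_Icc ((measurable_integral_condYgivenZ hf).comp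
      (f := fun t : 𝒳 × 𝒴 × 𝒵 => (t.2.2, t.1)) (by fun_prop))
      fun _ => integral_mem_Icc fun _ => hf01 _

/-- A common reference measure, σ-finite or not, forces `ℒ(Y ∣ X, Z) ≪ ℒ(Y ∣ Z)` almost surely. -/
lemma ae_condYgivenXZ_absolutelyContinuous {ν : Measure 𝒴} {p₁ : 𝒳 × 𝒵 → 𝒴 → ENNReal}
    {p₀ : 𝒵 → 𝒴 → ENNReal} (h₁ : IsCondDensityXZ μ ν p₁) (h₀ : IsCondDensityZ μ ν p₀) :
    ∀ᵐ t ∂μ, condYgivenXZ μ (t.1, t.2.2) ≪ condYgivenZ μ t.2.2 := by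
  have hS : MeasurableSet {u : 𝒵 × 𝒴 | p₀ u.1 u.2 ≠ 0} :=
    h₀.measurable (measurableSet_singleton 0).compl
  have hmZ : Measurable fun t : 𝒳 × 𝒴 × 𝒵 => t.2.2 := by fun_prop
  have hmXZ : Measurable fun t : 𝒳 × 𝒴 × 𝒵 => (t.1, t.2.2) := by fun_prop
  have hmY : Measurable fun t : 𝒳 × 𝒴 × 𝒵 => t.2.1 := by fun_prop
  -- the density `p₀` is almost surely positive at `(Y, Z)`
  have hpos : ∀ᵐ t ∂μ, p₀ t.2.2 t.2.1 ≠ 0 := by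
    have h : ∀ᵐ u ∂((μ.map fun t => t.2.2) ⊗ₘ condYgivenZ μ), p₀ u.1 u.2 ≠ 0 := by
      rw [Measure.ae_compProd_iff hS]
      filter_upwards [h₀.eq_withDensity] with z hz
      rw [hz, ae_withDensity_iff (h₀.measurable.of_uncurry_left)]
      exact ae_of_all _ fun _ h => h
    rw [condYgivenZ, compProd_map_condDistrib hmY.aemeasurable] at h
    exact ae_of_ae_map (hmZ.prodMk hmY).aemeasurable h
  have hpos' : ∀ᵐ t ∂μ, ∀ᵐ y ∂condYgivenXZ μ (t.1, t.2.2), p₀ t.2.2 y ≠ 0 := by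
    have hS' : MeasurableSet {u : (𝒳 × 𝒵) × 𝒴 | p₀ u.1.2 u.2 ≠ 0} :=
      (h₀.measurable.comp (f := fun u : (𝒳 × 𝒵) × 𝒴 => (u.1.2, u.2)) (by fun_prop))
        (measurableSet_singleton 0).compl
    have h : ∀ᵐ u ∂((μ.map fun t => (t.1, t.2.2)) ⊗ₘ condYgivenXZ μ), p₀ u.1.2 u.2 ≠ 0 := by
      rw [condYgivenXZ, compProd_map_condDistrib hmY.aemeasurable,
        ae_map_iff (hmXZ.prodMk hmY).aemeasurable hS']
      exact hpos
    exact ae_of_ae_map hmXZ.aemeasurable (Measure.ae_ae_of_ae_compProd h)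
  filter_upwards [hpos', ae_of_ae_map hmXZ.aemeasurable h₁.eq_withDensity,
    ae_of_ae_map hmZ.aemeasurable h₀.eq_withDensity] with t ht h1 h0
  intro B hB
  rw [h0, withDensity_apply_eq_zero h₀.measurable.of_uncurry_left] at hB
  have hB' : condYgivenXZ μ (t.1, t.2.2) ({y | p₀ t.2.2 y ≠ 0} ∩ B) = 0 := by
    rw [h1]
    exact withDensity_absolutelyContinuous _ _ hB
  refine measure_mono_null (fun y hy => ?_) (measure_union_null hB' (ae_iff.1 ht))
  by_cases h : p₀ t.2.2 y ≠ 0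
  · exact Or.inl ⟨h, hy⟩
  · exact Or.inr h

section Oracle

variable {ν : Measure 𝒴} {p₁ : 𝒳 × 𝒵 → 𝒴 → ENNReal} {p₀ : 𝒵 → 𝒴 → ENNReal}

/-- For almost every `(x, z)` the section of the oracle is a Hahn set, so it attains the total
variation distance. -/
lemma ae_tvDist_eq_oracle (h₁ : IsCondDensityXZ μ ν p₁) (h₀ : IsCondDensityZ μ ν p₀) :
    ∀ᵐ t ∂μ, tvDist (condYgivenXZ μ (t.1, t.2.2)) (condYgivenZ μ t.2.2)
      = ∫ y, oracle p₁ p₀ (t.1, y, t.2.2) ∂condYgivenXZ μ (t.1, t.2.2)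
        - ∫ y, oracle p₁ p₀ (t.1, y, t.2.2) ∂condYgivenZ μ t.2.2 := by
  filter_upwards [ae_of_ae_map (by fun_prop) h₁.eq_withDensity,
    ae_of_ae_map (by fun_prop) h₀.eq_withDensity] with t h1 h0
  rw [integral_oracle h₁.measurable h₀.measurable, integral_oracle h₁.measurable h₀.measurable]
  refine tvDist_eq_of_isHahnDecomposition ?_
  rw [h1, h0]
  exact isHahnDecomposition_withDensity h₁.measurable.of_uncurry_left h₀.measurable.of_uncurry_left

lemma integral_oracle_sub_eq_expectedTV (h₁ : IsCondDensityXZ μ ν p₁)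
    (h₀ : IsCondDensityZ μ ν p₀) :
    ∫ t, oracle p₁ p₀ t ∂μ
      - ∫ t, ∫ y, oracle p₁ p₀ (t.1, y, t.2.2) ∂condYgivenZ μ t.2.2 ∂μ = expectedTV μ := by
  have hm : Measurable (oracle p₁ p₀) := measurable_oracle h₁.measurable h₀.measurable
  rw [expectedTV, integral_congr_ae (ae_tvDist_eq_oracle h₁ h₀),
    integral_eq_integral_condYgivenXZ hm oracle_mem_Icc, integral_sub]
  · exact integrable_of_mem_Icc (measurable_integral_condYgivenXZ hm)
      fun _ => integral_mem_Icc fun _ => oracle_mem_Icc _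
  · exact integrable_of_mem_Icc ((measurable_integral_condYgivenZ hm).comp
      (f := fun t : 𝒳 × 𝒴 × 𝒵 => (t.2.2, t.1)) (by fun_prop))
      fun _ => integral_mem_Icc fun _ => oracle_mem_Icc _

/-- If the oracle almost surely rejects every resampled point, then `Y` and `X` are conditionally
independent given `Z`. -/
lemma expectedTV_eq_zero_of_oracle_resample_eq_zero [StandardBorelSpace 𝒳] [Nonempty 𝒳]
    (h₁ : IsCondDensityXZ μ ν p₁) (h₀ : IsCondDensityZ μ ν p₀)
    (h : ∀ᵐ t ∂μ, ∫ x, oracle p₁ p₀ (x, t.2.1, t.2.2) ∂condXgivenZ μ t.2.2 = 0) :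
    expectedTV μ = 0 := by
  have hm : Measurable (oracle p₁ p₀) := measurable_oracle h₁.measurable h₀.measurable
  have hswap := integral_condXgivenZ_eq_integral_condYgivenZ (μ := μ) hm oracle_mem_Icc
  rw [integral_congr_ae h, integral_zero] at hswap
  have h0 := (integral_eq_zero_iff_of_nonneg
    (fun t => (integral_mem_Icc fun _ => oracle_mem_Icc _).1)
    (integrable_of_mem_Icc ((measurable_integral_condYgivenZ hm).comp
      (f := fun t : 𝒳 × 𝒴 × 𝒵 => (t.2.2, t.1)) (by fun_prop))
      fun _ => integral_mem_Icc fun _ => oracle_mem_Icc _)).1 hswap.symm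
  refine integral_eq_zero_of_ae ?_
  filter_upwards [h0, ae_tvDist_eq_oracle h₁ h₀,
    ae_condYgivenXZ_absolutelyContinuous h₁ h₀] with t h0 htv hac
  rw [htv]
  simp only [Pi.zero_apply] at h0 ⊢
  rw [h0, sub_zero]
  rw [integral_oracle h₁.measurable h₀.measurable, measureReal_eq_zero_iff] at h0 ⊢
  exact hac h0

end Oracle

end Law

end Floodgate

/-! ### The losses of the algorithm -/

namespace Floodgate

open Filter Topology

section Loss

variable {Ω 𝒳 𝒴 𝒵 : Type*} {J : ℕ}

/-- The loss `L_i` of the `i`-th data point as a random variable. -/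
noncomputable def sampleLoss (f : 𝒳 × 𝒴 × 𝒵 → ℝ) (X : ℕ → Ω → 𝒳) (Y : ℕ → Ω → 𝒴)
    (Z : ℕ → Ω → 𝒵) (X' : ℕ → Fin J → Ω → 𝒳) (i : ℕ) (ω : Ω) : ℝ :=
  loss f (X i ω) (Y i ω) (Z i ω) fun j => X' i j ω

lemma loss_eq {f : 𝒳 × 𝒴 × 𝒵 → ℝ} (hf01 : ∀ t, f t ∈ Set.Icc (0 : ℝ) 1) (x : 𝒳) (y : 𝒴)
    (z : 𝒵) (x' : Fin J → 𝒳) :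
    loss f x y z x' = 1 - f (x, y, z) + (1 / (J : ℝ)) * ∑ j, f (x' j, y, z) := by
  unfold loss
  rw [abs_sub_comm, abs_of_nonneg (sub_nonneg.2 (hf01 _).2)]
  congr 2
  exact Finset.sum_congr rfl fun j _ => by rw [sub_zero, abs_of_nonneg (hf01 _).1]

lemma norm_loss_le {f : 𝒳 × 𝒴 × 𝒵 → ℝ} (hf01 : ∀ t, f t ∈ Set.Icc (0 : ℝ) 1) (x : 𝒳) (y : 𝒴)
    (z : 𝒵) (x' : Fin J → 𝒳) : ‖loss f x y z x'‖ ≤ 2 := by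
  have h0 : 0 ≤ (1 / (J : ℝ)) * ∑ j, f (x' j, y, z) :=
    mul_nonneg (by positivity) (Finset.sum_nonneg fun j _ => (hf01 _).1)
  have h1 : (1 / (J : ℝ)) * ∑ j, f (x' j, y, z) ≤ 1 := by
    have : ∑ j, f (x' j, y, z) ≤ (J : ℝ) := by
      simpa using Finset.sum_le_sum fun j (_ : j ∈ Finset.univ) => (hf01 (x' j, y, z)).2
    rw [one_div, inv_mul_eq_div]
    exact div_le_one_of_le₀ this (Nat.cast_nonneg _)
  have h2 := hf01 (x, y, z)
  rw [loss_eq hf01, Real.norm_of_nonneg (by linarith [h2.2])]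
  linarith [h2.1]

lemma normFactor_pos {k : ℕ∞} (hk : 2 ≤ k) : 0 < normFactor k := by
  unfold normFactor
  split_ifs with h
  · exact one_pos
  · have h2 : (2 : ℕ) ≤ k.toNat := by
      rw [← ENat.natCast_toNat h] at hk
      exact_mod_cast hk
    have h2' : (2 : ℝ) ≤ k.toNat := by exact_mod_cast h2
    rw [sub_pos, div_lt_one (by linarith)]
    linarith

/-- The lower confidence bound for `ETV` covers exactly if the upper confidence limit for the
expected loss is at least `1 - expectedTV μ`. -/
lemma lowerBound_le_ETV_iff [MeasurableSpace 𝒳] [MeasurableSpace 𝒴] [MeasurableSpace 𝒵]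
    [StandardBorelSpace 𝒴] [Nonempty 𝒴] {μ : Measure (𝒳 × 𝒴 × 𝒵)} [IsFiniteMeasure μ]
    {X : ℕ → Ω → 𝒳} {Y : ℕ → Ω → 𝒴} {Z : ℕ → Ω → 𝒵} {X' : ℕ → Fin J → Ω → 𝒳}
    (hY : 2 ≤ supportSizeY μ) (z : ℝ) (f : 𝒳 × 𝒴 × 𝒵 → ℝ)
    (n : ℕ) (ω : Ω) :
    ETV μ ≥ lowerBound (supportSizeY μ) z f X Y Z X' n ω ↔
      1 - expectedTV μ ≤ average n (fun i => sampleLoss f X Y Z X' i ω)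
        + z * empiricalSD (sampleLoss f X Y Z X') n ω / √(n : ℝ) := by
  have hk := normFactor_pos hY
  have hτ : 0 ≤ expectedTV μ := integral_nonneg fun _ => tvDist_nonneg _ _
  have hE : ETV μ = expectedTV μ / normFactor (supportSizeY μ) := by
    rw [ETV, expectedTV, one_div, inv_mul_eq_div]
  rw [ge_iff_le, hE, lowerBound, boundOfLosses, max_le_iff, div_le_div_iff_of_pos_right hk,
    and_iff_right (div_nonneg hτ hk.le)]
  unfold empiricalSD sampleLoss
  constructor <;> intro h <;> linarith

end Loss

section Algorithm

variable {Ω 𝒳 𝒴 𝒵 : Type*} [MeasurableSpace Ω] [MeasurableSpace 𝒳] [MeasurableSpace 𝒴]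
  [MeasurableSpace 𝒵] {J : ℕ}

lemma measurable_loss {f : 𝒳 × 𝒴 × 𝒵 → ℝ} (hf : Measurable f) :
    Measurable fun u : (𝒳 × 𝒴 × 𝒵) × (Fin J → 𝒳) => loss f u.1.1 u.1.2.1 u.1.2.2 u.2 := by
  have h : ∀ j, Measurable fun u : (𝒳 × 𝒴 × 𝒵) × (Fin J → 𝒳) => f (u.2 j, u.1.2.1, u.1.2.2) :=
    fun j => hf.comp (by fun_prop)
  unfold loss
  fun_prop

variable [StandardBorelSpace 𝒳] [Nonempty 𝒳] {P : Measure Ω} [IsProbabilityMeasure P]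
  {μ : Measure (𝒳 × 𝒴 × 𝒵)} [IsProbabilityMeasure μ]
  {X : ℕ → Ω → 𝒳} {Y : ℕ → Ω → 𝒴} {Z : ℕ → Ω → 𝒵} {X' : ℕ → Fin J → Ω → 𝒳}

namespace IsSample

lemma measurable_data (h : IsSample P μ J X Y Z X') (i : ℕ) :
    Measurable fun ω => (X i ω, Y i ω, Z i ω) :=
  (h.measurable_X i).prodMk ((h.measurable_Y i).prodMk (h.measurable_Z i))

lemma measurable_resamples (h : IsSample P μ J X Y Z X') (i : ℕ) :
    Measurable fun ω (j : Fin J) => X' i j ω :=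
  measurable_pi_lambda _ fun j => h.measurable_X' i j

lemma measurable_sampleLoss (h : IsSample P μ J X Y Z X') {f : 𝒳 × 𝒴 × 𝒵 → ℝ}
    (hf : Measurable f) (i : ℕ) : Measurable (sampleLoss f X Y Z X' i) :=
  (measurable_loss hf).comp ((h.measurable_data i).prodMk (h.measurable_resamples i))

lemma iIndepFun_sampleLoss (h : IsSample P μ J X Y Z X') {f : 𝒳 × 𝒴 × 𝒵 → ℝ}
    (hf : Measurable f) : iIndepFun (sampleLoss f X Y Z X') P :=
  h.indep.comp (fun _ u => loss f u.1.1 u.1.2.1 u.1.2.2 u.2) fun _ => measurable_loss hf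

/-- The law of a data point and the conditional law of its resamples determine their joint law,
which therefore does not depend on `i`. -/
lemma identDistrib_sampleLoss (h : IsSample P μ J X Y Z X') {f : 𝒳 × 𝒴 × 𝒵 → ℝ}
    (hf : Measurable f) (i : ℕ) :
    IdentDistrib (sampleLoss f X Y Z X' i) (sampleLoss f X Y Z X' 0) P P := by
  have hD : IdentDistrib (fun ω => ((X i ω, Y i ω, Z i ω), fun j : Fin J => X' i j ω))
      (fun ω => ((X 0 ω, Y 0 ω, Z 0 ω), fun j : Fin J => X' 0 j ω)) P P := by
    refine ⟨((h.measurable_data i).prodMk (h.measurable_resamples i)).aemeasurable,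
      ((h.measurable_data 0).prodMk (h.measurable_resamples 0)).aemeasurable, ?_⟩
    rw [← compProd_map_condDistrib (h.measurable_resamples i).aemeasurable,
      ← compProd_map_condDistrib (h.measurable_resamples 0).aemeasurable, h.law i, h.law 0]
    refine Measure.compProd_congr ?_
    filter_upwards [h.resample i, h.resample 0] with d hi h0
    rw [hi, h0]
  exact hD.comp (measurable_loss hf)

lemma memLp_sampleLoss (h : IsSample P μ J X Y Z X') {f : 𝒳 × 𝒴 × 𝒵 → ℝ}
    (hf : Measurable f) (hf01 : ∀ t, f t ∈ Set.Icc (0 : ℝ) 1) (i : ℕ) :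
    MemLp (sampleLoss f X Y Z X' i) 2 P :=
  MemLp.of_bound (h.measurable_sampleLoss hf i).aestronglyMeasurable 2
    (ae_of_all _ fun _ => norm_loss_le hf01 _ _ _ _)

/-- A classifier with values in `{0, 1}` whose loss is almost surely less than `1` rejects every
resampled point: otherwise all `J` independent resamples would be accepted at once with positive
probability, and the loss would be at least `1`. -/
lemma ae_resample_eq_zero_of_loss_lt_one (h : IsSample P μ J X Y Z X') (hJ : 1 ≤ J)
    {f : 𝒳 × 𝒴 × 𝒵 → ℝ} (hf : Measurable f) (hf01 : ∀ t, f t = 0 ∨ f t = 1)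
    (hlt : ∀ᵐ ω ∂P, sampleLoss f X Y Z X' 0 ω < 1) :
    ∀ᵐ t ∂μ, ∫ x, f (x, t.2.1, t.2.2) ∂condXgivenZ μ t.2.2 = 0 := by
  have hmem : ∀ t, f t ∈ Set.Icc (0 : ℝ) 1 := fun t => by
    rcases hf01 t with ht | ht <;> simp [ht]
  have hJ' : (J : ℝ) ≠ 0 := by positivity
  have hlt' : ∀ᵐ u ∂(μ ⊗ₘ condDistrib (fun ω (j : Fin J) => X' 0 j ω)
      (fun ω => (X 0 ω, Y 0 ω, Z 0 ω)) P), loss f u.1.1 u.1.2.1 u.1.2.2 u.2 < 1 := by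
    rw [← h.law 0, compProd_map_condDistrib (h.measurable_resamples 0).aemeasurable,
      ae_map_iff ((h.measurable_data 0).prodMk (h.measurable_resamples 0)).aemeasurable
        (measurableSet_lt (measurable_loss hf) measurable_const)]
    exact hlt
  filter_upwards [Measure.ae_ae_of_ae_compProd hlt', h.resample 0] with t ht hpi
  rw [hpi] at ht
  set B : Set 𝒳 := {x | f (x, t.2.1, t.2.2) = 1} with hB
  have hnull : (Measure.pi fun _ : Fin J => condXgivenZ μ t.2.2) (Set.univ.pi fun _ => B) = 0 := by
    refine measure_mono_null (fun x' hx' => ?_) (ae_iff.1 ht)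
    have hx : ∀ j, f (x' j, t.2.1, t.2.2) = 1 := fun j => hx' j (Set.mem_univ j)
    have := (hmem t).2
    simp only [loss_eq hmem, hx, Set.mem_ofPred_eq, not_lt, Finset.sum_const, Finset.card_univ,
      Fintype.card_fin, nsmul_eq_mul, mul_one, one_div, inv_mul_cancel₀ hJ', Prod.mk.eta]
    linarith
  rw [Measure.pi_pi, Finset.prod_const, Finset.card_univ, Fintype.card_fin] at hnull
  have hB0 : condXgivenZ μ t.2.2 B = 0 := pow_eq_zero_iff (by omega) |>.1 hnull
  refine integral_eq_zero_of_ae ?_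
  filter_upwards [measure_eq_zero_iff_ae_notMem.1 hB0] with x hx
  exact (hf01 _).resolve_right hx

variable [StandardBorelSpace 𝒴] [Nonempty 𝒴]

/-- The expected loss is `1` minus the amount by which `f` separates the law of `(X, Y, Z)` from
the law under which `X` and `Y` are conditionally independent given `Z`. -/
lemma integral_sampleLoss (h : IsSample P μ J X Y Z X') (hJ : 1 ≤ J) {f : 𝒳 × 𝒴 × 𝒵 → ℝ}
    (hf : Measurable f) (hf01 : ∀ t, f t ∈ Set.Icc (0 : ℝ) 1) :
    ∫ ω, sampleLoss f X Y Z X' 0 ω ∂P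
      = 1 - (∫ t, f t ∂μ - ∫ t, ∫ y, f (t.1, y, t.2.2) ∂condYgivenZ μ t.2.2 ∂μ) := by
  have hJ' : (J : ℝ) ≠ 0 := by positivity
  have hinner : ∀ t : 𝒳 × 𝒴 × 𝒵,
      ∫ x', loss f t.1 t.2.1 t.2.2 x' ∂(Measure.pi fun _ : Fin J => condXgivenZ μ t.2.2)
        = 1 - f t + ∫ x, f (x, t.2.1, t.2.2) ∂condXgivenZ μ t.2.2 := by
    intro t
    have hint : ∀ j : Fin J, Integrable (fun x' : Fin J → 𝒳 => f (x' j, t.2.1, t.2.2))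
        (Measure.pi fun _ : Fin J => condXgivenZ μ t.2.2) := fun j =>
      integrable_of_mem_Icc (hf.comp (by fun_prop)) fun _ => hf01 _
    have heval : ∀ j : Fin J, ∫ x', f (x' j, t.2.1, t.2.2)
        ∂(Measure.pi fun _ : Fin J => condXgivenZ μ t.2.2)
        = ∫ x, f (x, t.2.1, t.2.2) ∂condXgivenZ μ t.2.2 := fun j =>
      integral_comp_eval (μ := fun _ : Fin J => condXgivenZ μ t.2.2) (i := j)
        (f := fun x => f (x, t.2.1, t.2.2))
        (by fun_prop : Measurable _).aestronglyMeasurable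
    simp_rw [loss_eq hf01]
    rw [integral_add (integrable_const _) ((integrable_finsetSum _ fun j _ => hint j).const_mul _),
      integral_const_mul, integral_finsetSum _ fun j _ => hint j]
    simp only [heval, integral_const, Finset.sum_const, Finset.card_univ, Fintype.card_fin,
      nsmul_eq_mul, probReal_univ, smul_eq_mul]
    field_simp
  have h1 := integral_eq_integral_condDistrib (h.measurable_data 0) (h.measurable_resamples 0)
    (P := P) (measurable_loss hf) (fun u => norm_loss_le hf01 _ _ _ _)
  have h2 : ∫ ω, sampleLoss f X Y Z X' 0 ω ∂P
      = ∫ t, (1 - f t + ∫ x, f (x, t.2.1, t.2.2) ∂condXgivenZ μ t.2.2) ∂μ := by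
    have hmeas : Measurable fun t : 𝒳 × 𝒴 × 𝒵 =>
        1 - f t + ∫ x, f (x, t.2.1, t.2.2) ∂condXgivenZ μ t.2.2 :=
      (measurable_const.sub hf).add ((measurable_integral_condXgivenZ hf).comp
        (f := fun t : 𝒳 × 𝒴 × 𝒵 => (t.2.2, t.2.1)) (by fun_prop))
    have hmap := integral_map (h.measurable_data 0).aemeasurable (μ := P)
      hmeas.aestronglyMeasurable
    rw [h.law 0] at hmap
    refine h1.trans (Eq.trans (integral_congr_ae ?_) hmap.symm)
    have hpres : MeasurePreserving (fun ω => (X 0 ω, Y 0 ω, Z 0 ω)) P μ :=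
      ⟨h.measurable_data 0, h.law 0⟩
    filter_upwards [hpres.quasiMeasurePreserving.ae (h.resample 0)] with ω hω
    rw [hω]
    exact hinner (X 0 ω, Y 0 ω, Z 0 ω)
  have hA : Integrable (fun t : 𝒳 × 𝒴 × 𝒵 => ∫ x, f (x, t.2.1, t.2.2) ∂condXgivenZ μ t.2.2) μ :=
    integrable_of_mem_Icc ((measurable_integral_condXgivenZ hf).comp
      (f := fun t : 𝒳 × 𝒴 × 𝒵 => (t.2.2, t.2.1)) (by fun_prop))
      fun _ => integral_mem_Icc fun _ => hf01 _
  rw [h2, integral_add (f := fun t => 1 - f t)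
      ((integrable_const _).sub (integrable_of_mem_Icc hf hf01)) hA, integral_sub (integrable_const _) (integrable_of_mem_Icc hf hf01),
    integral_condXgivenZ_eq_integral_condYgivenZ hf hf01]
  simp
  ring

/-- The losses of the oracle are not degenerate if `X` and `Y` are conditionally dependent. -/
lemma variance_sampleLoss_oracle_ne_zero (h : IsSample P μ J X Y Z X') (hJ : 1 ≤ J)
    {ν : Measure 𝒴} {p₁ : 𝒳 × 𝒵 → 𝒴 → ENNReal} {p₀ : 𝒵 → 𝒴 → ENNReal}
    (h₁ : IsCondDensityXZ μ ν p₁) (h₀ : IsCondDensityZ μ ν p₀) (hpos : 0 < expectedTV μ) :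
    Var[sampleLoss (oracle p₁ p₀) X Y Z X' 0; P] ≠ 0 := by
  intro hvar
  have hm : Measurable (oracle p₁ p₀) := measurable_oracle h₁.measurable h₀.measurable
  refine hpos.ne' (expectedTV_eq_zero_of_oracle_resample_eq_zero h₁ h₀
    (h.ae_resample_eq_zero_of_loss_lt_one hJ hm (fun t => ?_) ?_))
  · unfold oracle
    split_ifs <;> simp
  · filter_upwards [ae_eq_integral_of_variance_eq_zero
      (h.memLp_sampleLoss hm oracle_mem_Icc 0) hvar] with ω hω
    rw [hω, h.integral_sampleLoss hJ hm oracle_mem_Icc,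
      integral_oracle_sub_eq_expectedTV h₁ h₀]
    linarith

end IsSample

end Algorithm

end Floodgate

/-! ### Coverage of the floodgate bound -/

theorem mainTheorem1
    {Ω 𝒳 𝒴 𝒵 : Type*} [MeasurableSpace Ω]
    [MeasurableSpace 𝒳] [StandardBorelSpace 𝒳] [Nonempty 𝒳]
    [MeasurableSpace 𝒴] [StandardBorelSpace 𝒴] [Nonempty 𝒴]
    [MeasurableSpace 𝒵]
    (P : Measure Ω) [IsProbabilityMeasure P]
    (μ : Measure (𝒳 × 𝒴 × 𝒵)) [IsProbabilityMeasure μ]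
    (hY : 2 ≤ Floodgate.supportSizeY μ)
    (J : ℕ) (hJ : 1 ≤ J)
    (X : ℕ → Ω → 𝒳) (Y : ℕ → Ω → 𝒴) (Z : ℕ → Ω → 𝒵) (X' : ℕ → Fin J → Ω → 𝒳)
    (hsample : Floodgate.IsSample P μ J X Y Z X')
    (α : ℝ) (hα : α ∈ Set.Ioo (0 : ℝ) 1)
    (zα : ℝ) (hzα : 1 - cdf (gaussianReal 0 1) zα = α) :
    (∀ f : 𝒳 × 𝒴 × 𝒵 → ℝ, Measurable f → (∀ t, f t ∈ Set.Icc (0 : ℝ) 1) →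
      ∃ c : ℝ, 1 - α ≤ c ∧
        Filter.Tendsto
          (fun n : ℕ => P.real {ω | Floodgate.ETV μ ≥
            Floodgate.lowerBound (Floodgate.supportSizeY μ) zα f X Y Z X' n ω})
          Filter.atTop (nhds c)) ∧
    (∀ (ν : Measure 𝒴) (p₁ : 𝒳 × 𝒵 → 𝒴 → ENNReal) (p₀ : 𝒵 → 𝒴 → ENNReal),
      Floodgate.IsCondDensityXZ μ ν p₁ → Floodgate.IsCondDensityZ μ ν p₀ →
      0 < Floodgate.ETV μ →
        Filter.Tendsto
          (fun n : ℕ => P.real {ω | Floodgate.ETV μ ≥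
            Floodgate.lowerBound (Floodgate.supportSizeY μ) zα
              (Floodgate.oracle p₁ p₀) X Y Z X' n ω})
          Filter.atTop (nhds (1 - α))) := by
  have hτ : ∀ f : 𝒳 × 𝒴 × 𝒵 → ℝ, Measurable f → (∀ t, f t ∈ Set.Icc (0 : ℝ) 1) →
      1 - Floodgate.expectedTV μ ≤ P[Floodgate.sampleLoss f X Y Z X' 0] := fun f hf hf01 => by
    rw [hsample.integral_sampleLoss hJ hf hf01]
    linarith [Floodgate.integral_condY_sub_le_expectedTV (μ := μ) hf hf01]
  have hcdf : cdf (gaussianReal 0 1) zα = 1 - α := by linarith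
  refine ⟨fun f hf hf01 => ?_, fun ν p₁ p₀ h₁ h₀ hpos => ?_⟩
  · simp_rw [Floodgate.lowerBound_le_ETV_iff hY]
    have hid := hsample.identDistrib_sampleLoss hf
    have hL2 := hsample.memLp_sampleLoss hf hf01 0
    by_cases hvar : Var[Floodgate.sampleLoss f X Y Z X' 0; P] = 0
    · exact ⟨1, by linarith [hα.1],
        Floodgate.tendsto_measureReal_upperLimit_of_variance_eq_zero hid hL2 zα (hτ f hf hf01) hvar⟩
    have hL := hsample.measurable_sampleLoss hf
    have hind := hsample.iIndepFun_sampleLoss hf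
    rcases (hτ f hf hf01).lt_or_eq with hlt | heq
    · exact ⟨1, by linarith [hα.1],
        Floodgate.tendsto_measureReal_upperLimit_of_lt hL hind hid hL2 zα hlt⟩
    · rw [heq]
      exact ⟨1 - α, le_rfl,
        hcdf ▸ Floodgate.tendsto_measureReal_upperLimit_mean hL hind hid hL2 zα hvar⟩
  · have hf := Floodgate.measurable_oracle h₁.measurable h₀.measurable
    have hτpos : 0 < Floodgate.expectedTV μ :=
      pos_of_mul_pos_right hpos (one_div_nonneg.2 (Floodgate.normFactor_pos hY).le)
    have hmean : 1 - Floodgate.expectedTV μ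
        = P[Floodgate.sampleLoss (Floodgate.oracle p₁ p₀) X Y Z X' 0] := by
      rw [hsample.integral_sampleLoss hJ hf Floodgate.oracle_mem_Icc,
        Floodgate.integral_oracle_sub_eq_expectedTV h₁ h₀]
    simp_rw [Floodgate.lowerBound_le_ETV_iff hY]
    rw [hmean, ← hcdf]
    exact Floodgate.tendsto_measureReal_upperLimit_mean (hsample.measurable_sampleLoss hf)
      (hsample.iIndepFun_sampleLoss hf) (hsample.identDistrib_sampleLoss hf)
      (hsample.memLp_sampleLoss hf Floodgate.oracle_mem_Icc 0) zα
      (hsample.variance_sampleLoss_oracle_ne_zero hJ h₁ h₀ hτpos)
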